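/- A \emph{local field} is a Hausdorff, locally compact, non-discrete topological field; it is \emph{Archimedean} if it is isomorphic, as a topological field, to $\mathbb{R}$ or to $\mathbb{C}$ with the Euclidean topology. For a field $F$ and $n\in\mathbb{N}$ let $\mathbb{P}^n_F=(F^{n+1}\setminus\{0\})/F^\times$. The line through two distinct points $[x],[y]\in\mathbb{P}^n_F$ is $\ell([x],[y])=\{[ax+by] : a,b\in F^\times\}\cup\{[x],[y]\}$, and $\mathcal{L}$ denotes the set of all these lines. A collineation of $\mathbb{P}^n_F$ is a pair of bijections $\alpha:\mathbb{P}^n_F\to\mathbb{P}^n_F$ and $\beta:\mathcal{L}\to\mathcal{L}$ such that $\ell(\alpha(p),\alpha(q))=\beta(\ell(p,q))$ for all distinct points $p,q$. An \emph{incidence abelian group structure} on $\mathbb{P}^n_F$ is an abelian group operation $\cdot$ on the set $\mathbb{P}^n_F$ such that, for every $a\in\mathbb{P}^n_F$, the translation $p\mapsto a\cdot p$ together with the map $\ell(p,q)\mapsto\ell(a\cdot p,a\cdot q)$ on lines is a collineation. If $F$ is a topological field, such a structure is \emph{continuous} if all these translations are continuous for the quotient topology on $\mathbb{P}^n_F$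 induced from $F^{n+1}\setminus\{0\}$. \textbf{Corollary.} Let $F$ be an Archimedean local field and let $n>1$ be an integer. Then $\mathbb{P}^n_F$ admits no incidence abelian group structure. In particular, it admits no continuous incidence abelian group structure. -/

import Mathlib

open scoped LinearAlgebra.Projectivization

/-- A local field: a topological field that is Hausdorff, locally compact and not discrete. -/
structure IsLocalField (F : Type*) [Field F] [TopologicalSpace F] : Prop where
  topologicalField : IsTopologicalDivisionRing F
  hausdorff : T2Space F
  locallyCompact : LocallyCompactSpace F
  nonDiscrete : ¬ DiscreteTopology F

/-- An Archimedean local field: a local field that is, as a topological field, the field of real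
numbers or the field of complex numbers with the Euclidean topology. -/
structure IsArchimedeanLocalField (F : Type*) [Field F] [TopologicalSpace F] : Prop
    extends IsLocalField F where
  real_or_complex : (∃ e : F ≃+* ℝ, IsHomeomorph e) ∨ (∃ e : F ≃+* ℂ, IsHomeomorph e)

/-- The standard topology on the projective space of a topological vector space `V`: the quotient
of the subspace topology on `V ∖ {0}`. -/
abbrev standardTopology (F V : Type*) [Field F] [AddCommGroup V] [Module F V]
    [TopologicalSpace V] : TopologicalSpace (ℙ F V) :=
  TopologicalSpace.coinduced (Projectivization.mk' F : {v : V // v ≠ 0} → ℙ F V) inferInstance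

/-- The line `ℓ(x, y)` (used for distinct points `x` and `y`): the points `x` and `y`, together with
all points represented by `a x + b y` with `a` and `b` nonzero scalars. This does not depend on the
representatives. -/
def projLine {F V : Type*} [Field F] [AddCommGroup V] [Module F V] (x y : ℙ F V) :
    Set (ℙ F V) :=
  {z | ∃ a b : F, a ≠ 0 ∧ b ≠ 0 ∧ z.rep = a • x.rep + b • y.rep} ∪ {x, y}

/-- The set of all lines of the projective geometry of `V`. -/
def projLines (F V : Type*) [Field F] [AddCommGroup V] [Module F V] : Set (Set (ℙ F V)) :=
  {l | ∃ x y : ℙ F V, x ≠ y ∧ l = projLine x y}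

/-- A pair of bijections, `α` of the set of points and `β` of the set of lines, is a collineation
if `ℓ(α x, α y) = β (ℓ(x, y))` for all distinct points `x` and `y`. -/
structure IsCollineation {F V : Type*} [Field F] [AddCommGroup V] [Module F V]
    (α : ℙ F V → ℙ F V) (β : projLines F V → projLines F V) : Prop where
  bijective_points : Function.Bijective α
  bijective_lines : Function.Bijective β
  map_line : ∀ (x y : ℙ F V) (h : x ≠ y),
    projLine (α x) (α y) = (β ⟨projLine x y, x, y, h, rfl⟩ : Set (ℙ F V))

/-- An abelian group structure on the set of points is an incidence abelian group structure if all
translations `x ↦ a * x` are (the point part of) collineations; the line part necessarily sends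
`ℓ(x, y)` to `ℓ(a * x, a * y)`. -/
def IsIncidenceGroup {F V : Type*} [Field F] [AddCommGroup V] [Module F V]
    (G : CommGroup (ℙ F V)) : Prop :=
  ∀ a : ℙ F V, ∃ β : projLines F V → projLines F V,
    IsCollineation (fun x => G.mul a x) β

/-- The projective geometry of `V` admits an incidence abelian group structure. -/
def AdmitsIncidenceAbelianGroup (F V : Type*) [Field F] [AddCommGroup V] [Module F V] : Prop :=
  ∃ G : CommGroup (ℙ F V), IsIncidenceGroup G

/-- The projective geometry of `V` admits a continuous incidence abelian group structure: in
addition all translations are continuous for the standard topology. -/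
def AdmitsContinuousIncidenceAbelianGroup (F V : Type*) [Field F] [AddCommGroup V] [Module F V]
    [TopologicalSpace V] : Prop :=
  ∃ G : CommGroup (ℙ F V), IsIncidenceGroup G ∧
    ∀ a : ℙ F V, @Continuous _ _ (standardTopology F V) (standardTopology F V) (fun x => G.mul a x)

/-! By the fundamental theorem of projective geometry (`IsLineMap.exists_semilinearMap`), each
translation lifts to a semilinear map, normalised so that the map attached to `v` sends a fixed
representative `one` of the identity to `v`. This gives a product on V = F^(n+1), of dimension at
least 3, that is commutative up to scalars and additive in the second variable.

Over ℂ the field endomorphism σ of such a lift may be wild. It is never the identity for `v` outside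
the line of `one`: a linear lift would have an eigenvector, and a translation with a fixed point is
trivial (`exists_ringHom_apply_ne`). Yet computing one product in both orders forces σ = id for some
such `v`. If some f·f lies outside span{1, f}, compare (1 + tf)(1 + sf) with its reverse. Otherwise
1, f, w, w·f are independent for suitable f and w, and (1 + tw)(1 + f) is compared with its reverse.

Over ℝ every lift is linear, since ℝ has no other ring endomorphism. Two lifts commute up to a
scalar, which is ±1 by determinants. Finitely many sign patterns cannot split V unless one of them
spans it. Quotients of lifts within that pattern generate a finite-dimensional commutative domain
over ℝ, hence a field of degree at most 2, which maps onto V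
(`finrank_le_two_of_commute_up_to_sign`). -/

/-! ### The fundamental theorem of projective geometry. -/

section SemilinearLift

variable {F V : Type*} [Field F] [AddCommGroup V] [Module F V]

open Submodule

theorem coeff_eq_zero_of_not_mem_span_pair {x y z : V} (hx : x ≠ 0) (hy : y ∉ F ∙ x)
    (hz : z ∉ span F {x, y}) {a b c : F} (h : a • x + b • y + c • z = 0) :
    a = 0 ∧ b = 0 ∧ c = 0 := by
  have hc : c = 0 := by
    by_contra hc
    refine hz (mem_span_pair.2 ⟨-(c⁻¹ * a), -(c⁻¹ * b), ?_⟩)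
    have : z = c⁻¹ • (c • z) := by rw [smul_smul, inv_mul_cancel₀ hc, one_smul]
    rw [this, eq_neg_of_add_eq_zero_right h]
    module
  subst hc
  have hb : b = 0 := by
    by_contra hb
    refine hy (mem_span_singleton.2 ⟨-(b⁻¹ * a), ?_⟩)
    have h' : a • x + b • y = 0 := by simpa using h
    have : y = b⁻¹ • (b • y) := by rw [smul_smul, inv_mul_cancel₀ hb, one_smul]
    rw [this, eq_neg_of_add_eq_zero_right h']
    module
  subst hb
  simpa [hx] using h

theorem coeff_eq_of_not_mem_span_pair {x y z : V} (hx : x ≠ 0) (hy : y ∉ F ∙ x)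
    (hz : z ∉ span F {x, y}) {a b c a' b' c' : F}
    (h : a • x + b • y + c • z = a' • x + b' • y + c' • z) :
    a = a' ∧ b = b' ∧ c = c' := by
  have := coeff_eq_zero_of_not_mem_span_pair hx hy hz (a := a - a') (b := b - b') (c := c - c')
    (by rw [← sub_eq_zero] at h; rw [← h]; module)
  exact ⟨sub_eq_zero.1 this.1, sub_eq_zero.1 this.2.1, sub_eq_zero.1 this.2.2⟩

theorem mem_span_pair_iff_le_sup {u v w : V} :
    u ∈ span F {v, w} ↔ F ∙ u ≤ (F ∙ v) ⊔ (F ∙ w) := by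
  rw [span_singleton_le_iff_mem, ← span_insert]

/-- The map on lines (given as a map from vectors to one-dimensional subspaces) preserves and
reflects collinearity. -/
structure IsLineMap (L : V → Submodule F V) : Prop where
  exists_eq_span : ∀ v, ∃ x, L v = F ∙ x
  map_zero : L 0 = ⊥
  le_sup_iff : ∀ u v w, L u ≤ L v ⊔ L w ↔ u ∈ span F {v, w}

namespace IsLineMap

variable {L : V → Submodule F V}

theorem le_iff (hL : IsLineMap L) (u v : V) : L u ≤ L v ↔ u ∈ F ∙ v := by
  simpa using hL.le_sup_iff u v v

theorem eq_bot_iff (hL : IsLineMap L) (u : V) : L u = ⊥ ↔ u = 0 := by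
  have := hL.le_iff u 0
  rwa [hL.map_zero, le_bot_iff, span_zero_singleton, mem_bot] at this

/-- On a complement `W` of a point `e`, the line map is induced by a vector-valued map `S` which
describes it in the affine chart `e + W`. -/
theorem exists_affine_lift (hL : IsLineMap L) {e e' : V} (he' : L e = F ∙ e')
    {W : Submodule F V} (heW : e ∉ W) {w : V} (hw : w ∈ W) :
    ∃ x, L w = F ∙ x ∧ L (e + w) = F ∙ (e' + x) := by
  by_cases hw0 : w = 0
  · exact ⟨0, by simp [hw0, hL.map_zero], by simp [hw0, he']⟩
  obtain ⟨y, hy⟩ := hL.exists_eq_span w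
  obtain ⟨z, hz⟩ := hL.exists_eq_span (e + w)
  have hmem : e + w ∈ span F {e, w} := mem_span_pair.2 ⟨1, 1, by simp⟩
  rw [← hL.le_sup_iff, hz, he', hy, ← mem_span_pair_iff_le_sup, mem_span_pair] at hmem
  obtain ⟨a, b, rfl⟩ := hmem
  have ha : a ≠ 0 := by
    rintro rfl
    have : L (e + w) ≤ L w := by
      rw [hz, hy, span_singleton_le_iff_mem, mem_span_singleton]
      exact ⟨b, by simp⟩
    rw [hL.le_iff, mem_span_singleton] at this
    obtain ⟨c, hc⟩ := this
    apply heW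
    rw [show e = c • w - w by rw [hc]; abel]
    exact W.sub_mem (W.smul_mem _ hw) hw
  have hb : b ≠ 0 := by
    rintro rfl
    have : L (e + w) ≤ L e := by
      rw [hz, he', span_singleton_le_iff_mem, mem_span_singleton]
      exact ⟨a, by simp⟩
    rw [hL.le_iff, mem_span_singleton] at this
    obtain ⟨c, hc⟩ := this
    have hw' : w = (c - 1) • e := by rw [sub_smul, hc]; simp
    have hc1 : c - 1 ≠ 0 := by
      intro h
      simp [h] at hw'
      exact hw0 hw'
    apply heW
    rw [show e = (c - 1)⁻¹ • w by rw [hw', smul_smul, inv_mul_cancel₀ hc1, one_smul]]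
    exact W.smul_mem _ hw
  -- `L (e + w)` is spanned by `a • e' + b • y`; dividing by `a` makes the coefficient of `e'` equal
  -- to 1.
  refine ⟨(a⁻¹ * b) • y, ?_, ?_⟩
  · rw [hy, span_singleton_smul_eq (IsUnit.mk0 _ (mul_ne_zero (inv_ne_zero ha) hb))]
  · rw [hz, ← span_singleton_smul_eq (IsUnit.mk0 _ ha) (e' + _), smul_add, smul_smul,
      mul_inv_cancel_left₀ ha]

theorem not_mem_span_singleton (hL : IsLineMap L) {x y x' y' : V} (hx : L x = F ∙ x')
    (hy : L y = F ∙ y') (h : y ∉ F ∙ x) : y' ∉ F ∙ x' := by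
  rwa [← span_singleton_le_iff_mem, ← hx, ← hy, hL.le_iff]

theorem not_mem_span_pair (hL : IsLineMap L) {x y z x' y' z' : V} (hx : L x = F ∙ x')
    (hy : L y = F ∙ y') (hz : L z = F ∙ z') (h : z ∉ span F {x, y}) : z' ∉ span F {x', y'} := by
  rwa [mem_span_pair_iff_le_sup, ← hx, ← hy, ← hz, hL.le_sup_iff]

theorem ne_zero (hL : IsLineMap L) {x x' : V} (hx : L x = F ∙ x') (h : x ≠ 0) : x' ≠ 0 := by
  rintro rfl
  rw [span_zero_singleton, hL.eq_bot_iff] at hx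
  exact h hx

/-- A vector outside the plane spanned by a vector of `W` and `e ∉ W`. -/
theorem _root_.not_mem_span_pair_of_not_mem {e : V} {W : Submodule F V} (heW : e ∉ W) {w₁ w₂ : V}
    (h₁ : w₁ ∈ W) (h₂ : w₂ ∈ W) (h : w₂ ∉ F ∙ w₁) : w₂ ∉ span F {e, w₁} := by
  intro h'
  obtain ⟨a, b, hab⟩ := mem_span_pair.1 h'
  have ha : a = 0 := by
    by_contra ha
    apply heW
    rw [show e = a⁻¹ • (w₂ - b • w₁) by
      rw [← hab, add_sub_cancel_right, smul_smul, inv_mul_cancel₀ ha, one_smul]]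
    exact W.smul_mem _ (W.sub_mem h₂ (W.smul_mem _ h₁))
  subst ha
  exact h (mem_span_singleton.2 ⟨b, by simpa using hab⟩)

theorem _root_.not_mem_span_singleton_of_not_mem {e : V} {W : Submodule F V} (heW : e ∉ W) {w : V}
    (h : w ∈ W) (hw : w ≠ 0) : w ∉ F ∙ e := by
  intro h'
  obtain ⟨a, rfl⟩ := mem_span_singleton.1 h'
  have ha : a ≠ 0 := by rintro rfl; simp at hw
  exact heW ((W.smul_mem_iff ha).1 h)

/-- The parallelogram construction: e + w₁ + w₂ is where the line through e + w₁ with direction w₂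
meets the line through e + w₂ with direction w₁. Coordinates in the independent images of e, w₁, w₂
then fix all scalars. -/
theorem affine_lift_add_of_not_mem (hL : IsLineMap L) {e e' : V} (he : L e = F ∙ e')
    {W : Submodule F V} (heW : e ∉ W) {S : V → V} (hS : ∀ w ∈ W, L w = F ∙ S w)
    (hS' : ∀ w ∈ W, L (e + w) = F ∙ (e' + S w)) {w₁ w₂ : V} (h₁ : w₁ ∈ W) (h₂ : w₂ ∈ W)
    (hw₁ : w₁ ≠ 0) (hw₂ : w₂ ∉ F ∙ w₁) : S (w₁ + w₂) = S w₁ + S w₂ := by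
  have he0 : e ≠ 0 := by rintro rfl; exact heW W.zero_mem
  have h₁₂ := W.add_mem h₁ h₂
  have hmem₁ : e + (w₁ + w₂) ∈ span F {e + w₁, w₂} := mem_span_pair.2 ⟨1, 1, by module⟩
  have hmem₂ : e + (w₁ + w₂) ∈ span F {e + w₂, w₁} := mem_span_pair.2 ⟨1, 1, by module⟩
  have hmem₃ : w₁ + w₂ ∈ span F {w₁, w₂} := mem_span_pair.2 ⟨1, 1, by module⟩
  rw [← hL.le_sup_iff, hS' _ h₁₂, hS' _ h₁, hS _ h₂, ← mem_span_pair_iff_le_sup,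
    mem_span_pair] at hmem₁
  rw [← hL.le_sup_iff, hS' _ h₁₂, hS' _ h₂, hS _ h₁, ← mem_span_pair_iff_le_sup,
    mem_span_pair] at hmem₂
  rw [← hL.le_sup_iff, hS _ h₁₂, hS _ h₂, hS _ h₁, ← mem_span_pair_iff_le_sup,
    mem_span_pair] at hmem₃
  obtain ⟨a, b, hab⟩ := hmem₁
  obtain ⟨c, d, hcd⟩ := hmem₂
  obtain ⟨p, q, hpq⟩ := hmem₃
  have hx := hL.ne_zero he he0
  have hy := hL.not_mem_span_singleton he (hS _ h₁)
    (not_mem_span_singleton_of_not_mem heW h₁ hw₁)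
  have hz := hL.not_mem_span_pair he (hS _ h₁) (hS _ h₂)
    (not_mem_span_pair_of_not_mem heW h₁ h₂ hw₂)
  rw [← hpq] at hab hcd ⊢
  obtain ⟨ha, hap, hbq⟩ := coeff_eq_of_not_mem_span_pair hx hy hz
    (a := a) (b := a) (c := b) (a' := 1) (b' := p) (c' := q)
    (by rw [one_smul, add_assoc e', ← hab]; module)
  obtain ⟨hc, hdp, hcq⟩ := coeff_eq_of_not_mem_span_pair hx hy hz
    (a := c) (b := d) (c := c) (a' := 1) (b' := p) (c' := q)
    (by rw [one_smul, add_assoc e', ← hcd]; module)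
  rw [← hap, ← hcq, ha, hc, one_smul, one_smul]

theorem affine_lift_add (hL : IsLineMap L) {e e' : V} (he : L e = F ∙ e')
    {W : Submodule F V} (heW : e ∉ W) (hW : ∀ w, ∃ w' ∈ W, w' ∉ F ∙ w)
    {S : V → V} (hS : ∀ w ∈ W, L w = F ∙ S w)
    (hS' : ∀ w ∈ W, L (e + w) = F ∙ (e' + S w)) {w₁ w₂ : V} (h₁ : w₁ ∈ W) (h₂ : w₂ ∈ W) :
    S (w₁ + w₂) = S w₁ + S w₂ := by
  have hS0 : S 0 = 0 := by
    have := hS 0 W.zero_mem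
    rwa [hL.map_zero, eq_comm, span_singleton_eq_bot] at this
  by_cases hw₁ : w₁ = 0
  · simp [hw₁, hS0]
  by_cases hw₂ : w₂ ∈ F ∙ w₁
  swap
  · exact hL.affine_lift_add_of_not_mem he heW hS hS' h₁ h₂ hw₁ hw₂
  by_cases hw₂0 : w₂ = 0
  · simp [hw₂0, hS0]
  -- For proportional vectors, expand S(w₁ + w₂ + w₃) in two ways, with w₃ off their common line, so
  -- that each sum used falls under the independent case.
  obtain ⟨w₃, h₃, hw₃⟩ := hW w₁
  have hle : ∀ {x : V}, x ∈ F ∙ w₁ → w₃ ∉ F ∙ x := fun hx h =>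
    hw₃ ((span_singleton_le_iff_mem _ _).2 hx h)
  have e₁ : S (w₁ + w₂ + w₃) = S (w₁ + w₂) + S w₃ := by
    by_cases h12 : w₁ + w₂ = 0
    · simp [h12, hS0]
    · exact hL.affine_lift_add_of_not_mem he heW hS hS' (W.add_mem h₁ h₂) h₃ h12
        (hle (add_mem (mem_span_singleton_self _) hw₂))
  have e₂ : S (w₁ + (w₂ + w₃)) = S w₁ + S (w₂ + w₃) :=
    hL.affine_lift_add_of_not_mem he heW hS hS' h₁ (W.add_mem h₂ h₃) hw₁
      (fun h => hw₃ (((F ∙ w₁).add_mem_iff_right hw₂).1 h))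
  have e₃ : S (w₂ + w₃) = S w₂ + S w₃ :=
    hL.affine_lift_add_of_not_mem he heW hS hS' h₂ h₃ hw₂0 (hle hw₂)
  rw [add_assoc, e₂, e₃, ← add_assoc] at e₁
  exact (add_right_cancel e₁).symm

/-- Additivity makes the factor by which S(a • w) scales S(w) the same for independent vectors,
hence, through a third vector, for all nonzero ones. The factor is then a function of `a` alone, and
it inherits the ring laws. -/
theorem exists_ringHom (hL : IsLineMap L) {W : Submodule F V} (hW : ∀ w, ∃ w' ∈ W, w' ∉ F ∙ w)
    {S : V → V} (hS : ∀ w ∈ W, L w = F ∙ S w)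
    (hadd : ∀ w₁ ∈ W, ∀ w₂ ∈ W, S (w₁ + w₂) = S w₁ + S w₂) :
    ∃ σ : F →+* F, ∀ a, ∀ w ∈ W, S (a • w) = σ a • S w := by
  have hex : ∀ a : F, ∀ w ∈ W, ∃ c : F, S (a • w) = c • S w := by
    intro a w hw
    have : L (a • w) ≤ L w := (hL.le_iff _ _).2 (mem_span_singleton.2 ⟨a, rfl⟩)
    rw [hS _ hw, hS _ (W.smul_mem a hw), span_singleton_le_iff_mem, mem_span_singleton] at this
    obtain ⟨c, hc⟩ := this
    exact ⟨c, hc.symm⟩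
  choose! s hs using hex
  have hindep : ∀ a, ∀ w₁ ∈ W, ∀ w₂ ∈ W, w₁ ≠ 0 → w₂ ∉ F ∙ w₁ → s a w₁ = s a w₂ := by
    intro a w₁ h₁ w₂ h₂ hw₁ hw₂
    have hx := hL.ne_zero (hS _ h₁) hw₁
    have hy := hL.not_mem_span_singleton (hS _ h₁) (hS _ h₂) hw₂
    have h := hs a _ (W.add_mem h₁ h₂)
    rw [smul_add, hadd _ (W.smul_mem _ h₁) _ (W.smul_mem _ h₂), hs a _ h₁, hs a _ h₂,
      hadd _ h₁ _ h₂, smul_add] at h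
    have hli := (LinearIndependent.pair_iff' (K := F) hx).2
      (fun a ha => hy (mem_span_singleton.2 ⟨a, ha⟩))
    have := LinearIndependent.pair_iff.1 hli (s a w₁ - s a (w₁ + w₂)) (s a w₂ - s a (w₁ + w₂))
      (by rw [← sub_eq_zero] at h; rw [← h]; module)
    rw [sub_eq_zero.1 this.1, sub_eq_zero.1 this.2]
  obtain ⟨w₀, h₀, hw₀⟩ := hW 0
  have hw₀ : w₀ ≠ 0 := by simpa using hw₀
  have key : ∀ a, ∀ w ∈ W, S (a • w) = s a w₀ • S w := by
    intro a w hw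
    by_cases hw0 : w = 0
    · have hS0 : S 0 = 0 := by
        have := hS 0 W.zero_mem
        rwa [hL.map_zero, eq_comm, span_singleton_eq_bot] at this
      simp [hw0, hS0]
    by_cases hww : w ∈ F ∙ w₀
    · obtain ⟨w₃, h₃, hw₃⟩ := hW w₀
      rw [hs a w hw, hindep a w hw w₃ h₃ hw0
        (fun h => hw₃ ((span_singleton_le_iff_mem _ _).2 hww h)), hindep a w₀ h₀ w₃ h₃ hw₀ hw₃]
    · rw [hs a w hw, hindep a w₀ h₀ w hw hw₀ hww]
  have hinj : ∀ a b : F, a • S w₀ = b • S w₀ → a = b := fun a b h =>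
    smul_left_injective F (hL.ne_zero (hS _ h₀) hw₀) h
  refine ⟨{ toFun := fun a => s a w₀, map_one' := ?_, map_mul' := ?_, map_zero' := ?_,
            map_add' := ?_ }, key⟩
  · apply hinj
    rw [← key 1 _ h₀, one_smul, one_smul]
  · intro a b
    apply hinj
    rw [← key _ _ h₀, mul_smul, key _ _ (W.smul_mem _ h₀), key _ _ h₀, smul_smul]
  · apply hinj
    rw [← key _ _ h₀, zero_smul, zero_smul]
    have := hS 0 W.zero_mem
    rwa [hL.map_zero, eq_comm, span_singleton_eq_bot] at this
  · intro a b
    apply hinj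
    rw [← key _ _ h₀, add_smul, hadd _ (W.smul_mem _ h₀) _ (W.smul_mem _ h₀), key _ _ h₀,
      key _ _ h₀, add_smul]

/-- The fundamental theorem of projective geometry. -/
theorem exists_semilinearMap (hL : IsLineMap L) (hdim : ∀ v w : V, ∃ u, u ∉ span F {v, w})
    {e e' : V} (he : e ≠ 0) (he' : L e = F ∙ e') :
    ∃ (σ : F →+* F) (T : V →ₛₗ[σ] V), T e = e' ∧ ∀ v, L v = F ∙ T v := by
  obtain ⟨W, hW⟩ := Submodule.exists_isCompl (F ∙ e)
  have heW : e ∉ W := fun h => he <| by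
    simpa using (disjoint_def.1 hW.disjoint e (mem_span_singleton_self e) h)
  have hdec : ∀ v, ∃ a : F, ∃ w ∈ W, v = a • e + w := by
    intro v
    have : v ∈ (F ∙ e) ⊔ W := by rw [hW.sup_eq_top]; trivial
    obtain ⟨x, hx, w, hw, rfl⟩ := mem_sup.1 this
    obtain ⟨a, rfl⟩ := mem_span_singleton.1 hx
    exact ⟨a, w, hw, rfl⟩
  have hW2 : ∀ w, ∃ w' ∈ W, w' ∉ F ∙ w := by
    intro w
    obtain ⟨u, hu⟩ := hdim e w
    obtain ⟨a, w', hw', rfl⟩ := hdec u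
    refine ⟨w', hw', fun h => hu ?_⟩
    obtain ⟨b, rfl⟩ := mem_span_singleton.1 h
    exact mem_span_pair.2 ⟨a, b, rfl⟩
  have hex : ∀ w ∈ W, ∃ x, L w = F ∙ x ∧ L (e + w) = F ∙ (e' + x) := fun w hw =>
    hL.exists_affine_lift he' heW hw
  choose! S hS hS' using hex
  have hadd : ∀ w₁ ∈ W, ∀ w₂ ∈ W, S (w₁ + w₂) = S w₁ + S w₂ := fun w₁ h₁ w₂ h₂ =>
    hL.affine_lift_add he' heW hW2 hS hS' h₁ h₂
  obtain ⟨σ, hσ⟩ := hL.exists_ringHom hW2 hS hadd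
  choose a p hp hap using hdec
  have huniq : ∀ v (b : F), ∀ w ∈ W, v = b • e + w → a v = b ∧ p v = w := by
    intro v b w hw hv
    have h : (a v - b) • e = w - p v := by
      have := hap v
      rw [sub_smul, sub_eq_sub_iff_add_eq_add, ← this, hv, add_comm]
    have h0 : a v - b = 0 := by
      by_contra h0
      exact heW ((W.smul_mem_iff h0).1 (h ▸ W.sub_mem hw (hp v)))
    rw [h0, zero_smul, eq_comm, sub_eq_zero] at h
    exact ⟨sub_eq_zero.1 h0, h.symm⟩
  let T : V →ₛₗ[σ] V :=
    { toFun := fun v => σ (a v) • e' + S (p v)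
      map_add' := by
        intro v w
        obtain ⟨h₁, h₂⟩ := huniq (v + w) (a v + a w) (p v + p w) (W.add_mem (hp v) (hp w))
          (by nth_rw 1 [hap v, hap w]; module)
        simp only [h₁, h₂, map_add, hadd _ (hp v) _ (hp w)]
        module
      map_smul' := by
        intro c v
        obtain ⟨h₁, h₂⟩ := huniq (c • v) (c * a v) (c • p v) (W.smul_mem _ (hp v))
          (by nth_rw 1 [hap v]; module)
        simp only [h₁, h₂, map_mul, hσ _ _ (hp v)]
        module }
  have hT : ∀ v, T v = σ (a v) • e' + S (p v) := fun v => rfl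
  have hS0 : S 0 = 0 := by
    have := hS 0 W.zero_mem
    rwa [hL.map_zero, eq_comm, span_singleton_eq_bot] at this
  refine ⟨σ, T, ?_, fun v => ?_⟩
  · obtain ⟨h₁, h₂⟩ := huniq e 1 0 W.zero_mem (by simp)
    rw [hT, h₁, h₂, hS0, map_one, one_smul, add_zero]
  · rw [hT]
    by_cases h0 : a v = 0
    · have := hap v
      rw [h0, zero_smul, zero_add] at this
      rw [h0, _root_.map_zero, zero_smul, zero_add, ← hS _ (hp v), ← this]
    · have hσ0 : σ (a v) ≠ 0 := (map_ne_zero σ).2 h0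
      have h₁ : σ (a v) • e' + S (p v) = σ (a v) • (e' + S ((a v)⁻¹ • p v)) := by
        rw [hσ _ _ (hp v), map_inv₀, smul_add, smul_smul, mul_inv_cancel₀ hσ0, one_smul]
      rw [h₁, span_singleton_smul_eq (IsUnit.mk0 _ hσ0), ← hS' _ (W.smul_mem _ (hp v))]
      have h₂ : v = a v • (e + (a v)⁻¹ • p v) := by
        rw [smul_add, smul_smul, mul_inv_cancel₀ h0, one_smul, ← hap v]
      apply le_antisymm
      · exact (hL.le_iff _ _).2 (mem_span_singleton.2 ⟨_, h₂.symm⟩)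
      · refine (hL.le_iff _ _).2 ?_
        refine mem_span_singleton.2 ⟨(a v)⁻¹, ?_⟩
        nth_rw 2 [h₂]
        rw [smul_smul, inv_mul_cancel₀ h0, one_smul]

end IsLineMap

end SemilinearLift

/-! ### From incidence groups to semilinear products. -/

section IncidenceProduct

variable {F V : Type*} [Field F] [AddCommGroup V] [Module F V]

open Submodule

theorem Projectivization.eq_of_submodule_le {x y : ℙ F V} (h : x.submodule ≤ y.submodule) :
    x = y := by
  rw [x.submodule_eq, y.submodule_eq, span_singleton_le_iff_mem, mem_span_singleton] at h
  rw [← x.mk_rep, ← y.mk_rep, Projectivization.mk_eq_mk_iff']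
  exact h

theorem Projectivization.submodule_ne_bot (x : ℙ F V) : x.submodule ≠ ⊥ := by
  rw [x.submodule_eq, ne_eq, span_singleton_eq_bot]
  exact x.rep_nonzero

theorem mem_projLine_iff {x y z : ℙ F V} :
    z ∈ projLine x y ↔ z.submodule ≤ x.submodule ⊔ y.submodule := by
  constructor
  · rintro (⟨a, b, -, -, h⟩ | rfl | rfl)
    · rw [x.submodule_eq, y.submodule_eq, z.submodule_eq, ← mem_span_pair_iff_le_sup,
        mem_span_pair]
      exact ⟨a, b, h.symm⟩
    · exact le_sup_left
    · exact le_sup_right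
  · intro h
    rw [x.submodule_eq, y.submodule_eq, z.submodule_eq, ← mem_span_pair_iff_le_sup,
        mem_span_pair] at h
    obtain ⟨a, b, h⟩ := h
    by_cases ha : a = 0
    · refine Or.inr (Or.inr (Projectivization.eq_of_submodule_le ?_))
      rw [y.submodule_eq, z.submodule_eq, span_singleton_le_iff_mem, mem_span_singleton]
      exact ⟨b, by simpa [ha] using h⟩
    by_cases hb : b = 0
    · refine Or.inr (Or.inl (Projectivization.eq_of_submodule_le ?_))
      rw [x.submodule_eq, z.submodule_eq, span_singleton_le_iff_mem, mem_span_singleton]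
      exact ⟨a, by simpa [hb] using h⟩
    exact Or.inl ⟨a, b, ha, hb, h.symm⟩

theorem projLine_eq_of_mem {x y z : ℙ F V} (hz : z ∈ projLine x y) (hzx : z ≠ x) :
    projLine x z = projLine x y := by
  have hsup : x.submodule ⊔ z.submodule = x.submodule ⊔ y.submodule := by
    apply le_antisymm
    · exact sup_le le_sup_left (mem_projLine_iff.1 hz)
    · refine sup_le le_sup_left ?_
      rcases hz with ⟨a, b, -, hb, h⟩ | rfl | rfl
      · rw [x.submodule_eq, y.submodule_eq, z.submodule_eq, ← mem_span_pair_iff_le_sup,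
          mem_span_pair, h]
        refine ⟨-(b⁻¹ * a), b⁻¹, ?_⟩
        rw [smul_add, smul_smul, smul_smul, inv_mul_cancel₀ hb]
        module
      · exact absurd rfl hzx
      · exact le_sup_right
  ext w
  rw [mem_projLine_iff, mem_projLine_iff, hsup]

theorem IsCollineation.submodule_le_sup {α : ℙ F V → ℙ F V} {β : projLines F V → projLines F V}
    (h : IsCollineation α β) {x y z : ℙ F V} (hz : z.submodule ≤ x.submodule ⊔ y.submodule) :
    (α z).submodule ≤ (α x).submodule ⊔ (α y).submodule := by
  by_cases hxy : x = y
  · subst hxy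
    rw [sup_idem] at hz
    rw [Projectivization.eq_of_submodule_le hz]
    exact le_sup_left
  by_cases hzx : z = x
  · rw [hzx]
    exact le_sup_left
  rw [← mem_projLine_iff] at hz ⊢
  have h₁ := h.map_line x y hxy
  have h₂ := h.map_line x z (Ne.symm hzx)
  have h₃ : (⟨projLine x z, x, z, Ne.symm hzx, rfl⟩ : projLines F V) =
      ⟨projLine x y, x, y, hxy, rfl⟩ := Subtype.ext (projLine_eq_of_mem hz hzx)
  rw [h₁, ← h₃, ← h₂]
  exact Or.inr (Or.inr rfl)

theorem IsIncidenceGroup.submodule_le_sup_iff {G : CommGroup (ℙ F V)} (hG : IsIncidenceGroup G)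
    (a x y z : ℙ F V) : (G.mul a z).submodule ≤ (G.mul a x).submodule ⊔ (G.mul a y).submodule ↔
      z.submodule ≤ x.submodule ⊔ y.submodule := by
  let := G
  have hinv : ∀ x : ℙ F V, G.mul a⁻¹ (G.mul a x) = x := fun x => inv_mul_cancel_left a x
  obtain ⟨β, hβ⟩ := hG a
  obtain ⟨γ, hγ⟩ := hG a⁻¹
  refine ⟨fun h => ?_, fun h => hβ.submodule_le_sup h⟩
  simpa only [hinv] using hγ.submodule_le_sup h

open Classical in
/-- The subspace attached to a vector by a map of the projective space. -/
noncomputable def lineOf (α : ℙ F V → ℙ F V) (v : V) : Submodule F V :=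
  if h : v ≠ 0 then (α (Projectivization.mk F v h)).submodule else ⊥

theorem lineOf_zero (α : ℙ F V → ℙ F V) : lineOf α 0 = ⊥ := by simp [lineOf]

theorem lineOf_of_ne_zero (α : ℙ F V → ℙ F V) {v : V} (h : v ≠ 0) :
    lineOf α v = (α (Projectivization.mk F v h)).submodule := by simp [lineOf, h]

theorem isLineMap_lineOf {α : ℙ F V → ℙ F V}
    (hα : ∀ x y z, (α z).submodule ≤ (α x).submodule ⊔ (α y).submodule ↔
      z.submodule ≤ x.submodule ⊔ y.submodule) : IsLineMap (lineOf α) where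
  exists_eq_span v := by
    by_cases h : v = 0
    · exact ⟨0, by simp [h, lineOf_zero]⟩
    · exact ⟨_, by rw [lineOf_of_ne_zero α h, Projectivization.submodule_eq]⟩
  map_zero := lineOf_zero α
  le_sup_iff u v w := by
    have key : ∀ u v w : V, v ≠ 0 → w ≠ 0 →
        (lineOf α u ≤ lineOf α v ⊔ lineOf α w ↔ u ∈ span F {v, w}) := by
      intro u v w hv hw
      by_cases hu : u = 0
      · simp [hu, lineOf_zero]
      · rw [lineOf_of_ne_zero α hu, lineOf_of_ne_zero α hv, lineOf_of_ne_zero α hw, hα,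
          Projectivization.submodule_mk, Projectivization.submodule_mk,
          Projectivization.submodule_mk, mem_span_pair_iff_le_sup]
    by_cases hv : v = 0
    · by_cases hw : w = 0
      · by_cases hu : u = 0
        · simp [hu, lineOf_zero]
        · simp [hu, hv, hw, lineOf_zero, lineOf_of_ne_zero α hu,
            Projectivization.submodule_ne_bot]
      · have := key u w w hw hw
        rw [hv, lineOf_zero, bot_sup_eq, span_insert_zero]
        rwa [sup_idem, Set.pair_eq_singleton] at this
    · by_cases hw : w = 0
      · have := key u v v hv hv
        rw [hw, lineOf_zero, sup_bot_eq, Set.pair_comm, span_insert_zero]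
        rwa [sup_idem, Set.pair_eq_singleton] at this
      · exact key u v w hv hw

variable (F V) in
/-- A product on `V`, semilinear in the second variable, that induces an abelian group of
collineations acting transitively on the projective space. -/
structure SemilinearProduct where
  one : V
  one_ne_zero : one ≠ 0
  σ : V → F →+* F
  mul : ∀ v, V →ₛₗ[σ v] V
  mul_one : ∀ v, mul v one = v
  mem_span_pair_iff : ∀ v, v ≠ 0 → ∀ u x y,
    mul v u ∈ span F {mul v x, mul v y} ↔ u ∈ span F {x, y}
  span_mul_comm : ∀ v w, (F ∙ mul v w) = F ∙ mul w v
  span_mul_left_comm : ∀ u v w, (F ∙ mul u (mul v w)) = F ∙ mul v (mul u w)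
  exists_span_mul_eq : ∀ x, x ≠ 0 → ∀ y, ∃ w, (F ∙ mul w x) = F ∙ y

theorem IsIncidenceGroup.nonempty_semilinearProduct {G : CommGroup (ℙ F V)}
    (hG : IsIncidenceGroup G) (hdim : ∀ v w : V, ∃ u, u ∉ span F {v, w}) :
    Nonempty (SemilinearProduct F V) := by
  let := G
  obtain ⟨e, he0, he⟩ : ∃ (e : V) (h : e ≠ 0), Projectivization.mk F e h = 1 :=
    ⟨_, (1 : ℙ F V).rep_nonzero, (1 : ℙ F V).mk_rep⟩
  have hL : ∀ a : ℙ F V, IsLineMap (lineOf (G.mul a)) := fun a =>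
    isLineMap_lineOf (hG.submodule_le_sup_iff a)
  have hex : ∀ v : V, ∃ (σ : F →+* F) (T : V →ₛₗ[σ] V), T e = v ∧
      (v = 0 → T = 0) ∧
      ∀ h : v ≠ 0, ∀ w, lineOf (G.mul (Projectivization.mk F v h)) w = F ∙ T w := by
    intro v
    by_cases hv : v = 0
    · exact ⟨RingHom.id F, 0, by simp [hv], fun _ => rfl, fun h => absurd hv h⟩
    -- The image of `e` may be any representative of its class; taking `v` itself gives the law v·1
    -- = v exactly, not just up to a scalar.
    · obtain ⟨σ, T, h₁, h₂⟩ := (hL (Projectivization.mk F v hv)).exists_semilinearMap hdim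
        (e' := v) he0 (by
          rw [lineOf_of_ne_zero _ he0, he, ← Projectivization.submodule_mk v hv]
          exact congrArg _ (_root_.mul_one (Projectivization.mk F v hv)))
      exact ⟨σ, T, h₁, fun h => absurd h hv, fun _ => h₂⟩
  choose σ T hTe hT0 hT using hex
  have hTmk : ∀ v w (hv : v ≠ 0) (hw : w ≠ 0), (F ∙ T v w) =
      (Projectivization.mk F v hv * Projectivization.mk F w hw).submodule := by
    intro v w hv hw
    rw [← hT v hv, lineOf_of_ne_zero _ hw]
    rfl
  have hTne : ∀ v w, v ≠ 0 → w ≠ 0 → T v w ≠ 0 := by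
    intro v w hv hw h
    have := hTmk v w hv hw
    rw [h, span_zero_singleton] at this
    exact Projectivization.submodule_ne_bot _ this.symm
  have hTmk' : ∀ v w (hv : v ≠ 0) (hw : w ≠ 0), Projectivization.mk F (T v w) (hTne v w hv hw) =
      Projectivization.mk F v hv * Projectivization.mk F w hw := by
    intro v w hv hw
    apply Projectivization.eq_of_submodule_le
    rw [Projectivization.submodule_mk, hTmk v w hv hw]
  refine ⟨⟨e, he0, σ, T, hTe, ?_, ?_, ?_, ?_⟩⟩
  · intro v hv u x y
    rw [mem_span_pair_iff_le_sup, ← hT v hv, ← hT v hv, ← hT v hv, (hL _).le_sup_iff]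
  · intro v w
    by_cases hv : v = 0
    · simp [hT0 v hv, hv]
    by_cases hw : w = 0
    · simp [hT0 w hw, hw]
    rw [hTmk v w hv hw, hTmk w v hw hv, mul_comm]
  · intro u v w
    by_cases hu : u = 0
    · simp [hT0 u hu]
    by_cases hv : v = 0
    · simp [hT0 v hv]
    by_cases hw : w = 0
    · simp [hw]
    rw [hTmk u _ hu (hTne v w hv hw), hTmk v _ hv (hTne u w hu hw), hTmk', hTmk',
      mul_left_comm]
    all_goals assumption
  · intro x hx y
    by_cases hy : y = 0
    · exact ⟨0, by simp [hT0 0 rfl, hy]⟩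
    obtain ⟨w, hw, h⟩ : ∃ (w : V) (hw : w ≠ 0), Projectivization.mk F w hw =
        Projectivization.mk F y hy * (Projectivization.mk F x hx)⁻¹ :=
      ⟨_, Projectivization.rep_nonzero _, Projectivization.mk_rep _⟩
    refine ⟨w, ?_⟩
    rw [hTmk w x hw hx, h, inv_mul_cancel_right, Projectivization.submodule_mk]

end IncidenceProduct

/-! ### Algebraically closed fields: eigenvectors against commutativity. -/

section AlgClosed

namespace SemilinearProduct

variable {F V : Type*} [Field F] [AddCommGroup V] [Module F V] (P : SemilinearProduct F V)

open Submodule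

theorem mem_span_singleton_iff {v : V} (hv : v ≠ 0) (u x : V) :
    P.mul v u ∈ F ∙ P.mul v x ↔ u ∈ F ∙ x := by
  simpa using P.mem_span_pair_iff v hv u x x

theorem mul_ne_zero {v w : V} (hv : v ≠ 0) (hw : w ≠ 0) : P.mul v w ≠ 0 := by
  intro h
  have := (P.mem_span_singleton_iff hv w 0).1 (by rw [h]; exact zero_mem _)
  exact hw (by simpa using this)

theorem exists_mul_eq_smul_mul (v w : V) : ∃ c : F, P.mul v w = c • P.mul w v := by
  have := mem_span_singleton_self (R := F) (P.mul v w)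
  rw [P.span_mul_comm, mem_span_singleton] at this
  obtain ⟨c, hc⟩ := this
  exact ⟨c, hc.symm⟩

theorem mem_span_one_of_mul_mem {v w : V} (hw : w ≠ 0) (h : P.mul v w ∈ F ∙ w) :
    v ∈ F ∙ P.one := by
  rw [← P.mem_span_singleton_iff hw, P.mul_one]
  rwa [← span_singleton_le_iff_mem, P.span_mul_comm, span_singleton_le_iff_mem] at h

/-- A linear lift would have an eigenvector, that is, the translation would fix a point. -/
theorem exists_ringHom_apply_ne [IsAlgClosed F] [FiniteDimensional F V] {v : V}
    (h : v ∉ F ∙ P.one) : ∃ a, P.σ v a ≠ a := by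
  by_contra! hσ
  let f : V →ₗ[F] V :=
    { toFun := P.mul v
      map_add' := map_add _
      map_smul' := fun a x => by simp [hσ] }
  have : Nontrivial V := ⟨⟨P.one, 0, P.one_ne_zero⟩⟩
  obtain ⟨μ, hμ⟩ := Module.End.exists_eigenvalue f
  obtain ⟨w, hw⟩ := hμ.exists_hasEigenvector
  exact h (P.mem_span_one_of_mul_mem hw.2 (mem_span_singleton.2 ⟨μ, hw.apply_eq_smul.symm⟩))

theorem ringHom_apply_eq_of_mul_self_not_mem [NeZero (2 : F)] {f : V} (hf : f ∉ F ∙ P.one)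
    (hff : P.mul f f ∉ span F {P.one, f}) (t : F) : P.σ f t = t := by
  have hk : ∀ t : F, ∃ k : F, P.mul (P.one + t • f) f = k • (f + P.σ f t • P.mul f f) := by
    intro t
    obtain ⟨k, hk⟩ := P.exists_mul_eq_smul_mul (P.one + t • f) f
    exact ⟨k, by rw [hk, map_add, map_smulₛₗ, P.mul_one]⟩
  choose k hk using hk
  -- Compare (1 + tf)(1 + sf) with its reverse in the coordinates 1, f, f·f; the first coordinate
  -- forces the scalar between them to be 1.
  have key : ∀ s t : F, P.σ (P.one + t • f) s * k t * (P.σ f s - P.σ f t) =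
      (s - t) * P.σ f s := by
    intro s t
    obtain ⟨c, hc⟩ := P.exists_mul_eq_smul_mul (P.one + t • f) (P.one + s • f)
    rw [map_add, map_smulₛₗ, P.mul_one, hk, map_add, map_smulₛₗ, P.mul_one, hk] at hc
    obtain ⟨h₁, h₂, h₃⟩ := coeff_eq_of_not_mem_span_pair P.one_ne_zero hf hff
      (a := 1) (b := t + P.σ (P.one + t • f) s * k t)
      (c := P.σ (P.one + t • f) s * k t * P.σ f t)
      (a' := c) (b' := c * (s + P.σ (P.one + s • f) t * k s))
      (c' := c * (P.σ (P.one + s • f) t * k s * P.σ f s))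
      (by
        refine Eq.trans ?_ (hc.trans ?_) <;> module)
    subst h₁
    linear_combination P.σ f s * h₂ - h₃
  -- 1 and 2 are fixed by every ring endomorphism, so these two values of `s` give two equations in
  -- k(t) and σ(t) only.
  have h₁ := key 1 t
  have h₂ := key 2 t
  rw [map_one, map_one, one_mul, _root_.mul_one] at h₁
  rw [map_ofNat, map_ofNat] at h₂
  have h₃ : k t * (2 - P.σ f t) = 2 - t :=
    mul_left_cancel₀ (two_ne_zero (α := F)) (by linear_combination h₂)
  have h₄ : k t = 1 := by linear_combination h₃ - h₁
  rw [h₄] at h₁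
  linear_combination -h₁

/-- Projectively, the line through 1 and f behaves like a subgroup: for q on it, q ≠ 1, translation
by q carries the line through 1 and q to the one through q and q·q, which is the same line. -/
theorem mem_span_pair_of_mul_mem (h : ∀ f, P.mul f f ∈ span F {P.one, f}) {f q w : V}
    (hq0 : q ≠ 0) (hw : w ≠ 0) (hq : q ∈ span F {P.one, f})
    (hqw : P.mul w q ∈ span F {P.one, f}) : w ∈ span F {P.one, f} := by
  have hqw' : P.mul q w ∈ span F {P.one, f} := by
    rwa [← span_singleton_le_iff_mem, P.span_mul_comm, span_singleton_le_iff_mem]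
  by_cases hq1 : q ∈ F ∙ P.one
  · have h₁ : P.mul w q ∈ F ∙ w := by
      rw [← P.mem_span_singleton_iff hw, P.mul_one] at hq1
      exact hq1
    obtain ⟨c, hc⟩ := mem_span_singleton.1 h₁
    have hc0 : c ≠ 0 := by
      rintro rfl
      exact P.mul_ne_zero hw hq0 (by simpa using hc.symm)
    rw [← hc] at hqw
    exact ((span F {P.one, f}).smul_mem_iff hc0).1 hqw
  · have hone : P.one ∈ span F {P.mul q P.one, P.mul q q} := by
      obtain ⟨a, b, hab⟩ := mem_span_pair.1 (h q)
      have ha : a ≠ 0 := by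
        rintro rfl
        apply hq1
        rw [← P.mem_span_singleton_iff hq0, P.mul_one]
        exact mem_span_singleton.2 ⟨b, by simpa using hab⟩
      refine mem_span_pair.2 ⟨-(a⁻¹ * b), a⁻¹, ?_⟩
      rw [← hab, P.mul_one, smul_add, smul_smul, smul_smul, inv_mul_cancel₀ ha]
      module
    have hq' : q ∈ span F {P.mul q P.one, P.mul q q} := by
      rw [P.mul_one]
      exact subset_span (by simp)
    have hf : f ∈ span F {P.one, q} := by
      obtain ⟨a, b, hab⟩ := mem_span_pair.1 hq
      have hb : b ≠ 0 := by
        rintro rfl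
        exact hq1 (mem_span_singleton.2 ⟨a, by simpa using hab⟩)
      refine mem_span_pair.2 ⟨-(b⁻¹ * a), b⁻¹, ?_⟩
      rw [← hab, smul_add, smul_smul, smul_smul, inv_mul_cancel₀ hb]
      module
    have hle₁ : span F {P.one, q} ≤ span F {P.mul q P.one, P.mul q q} := by
      rw [span_le, Set.pair_subset_iff]
      exact ⟨hone, hq'⟩
    have hle₂ : span F {P.one, f} ≤ span F {P.one, q} := by
      rw [span_le, Set.pair_subset_iff]
      exact ⟨subset_span (by simp), hf⟩
    have hle₃ : span F {P.one, q} ≤ span F {P.one, f} := by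
      rw [span_le, Set.pair_subset_iff]
      exact ⟨subset_span (by simp), hq⟩
    exact hle₃ ((P.mem_span_pair_iff q hq0 w P.one q).1 (hle₁ (hle₂ hqw')))

/-- Otherwise x1 + yf would lie on the translate by w of the line through 1 and f. It would be w·q
up to a scalar with q on that line, and w would be a quotient of two of its points. -/
theorem mul_not_mem_span_triple (h : ∀ f, P.mul f f ∈ span F {P.one, f}) {f w : V}
    (hf : f ∉ F ∙ P.one) (hw : w ∉ span F {P.one, f}) (x y z : F) :
    P.mul w f ≠ x • P.one + y • f + z • w := by
  intro hxyz
  have hw0 : w ≠ 0 := by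
    rintro rfl
    exact hw (zero_mem _)
  obtain ⟨q, hq⟩ := P.exists_span_mul_eq w hw0 (x • P.one + y • f)
  rw [P.span_mul_comm] at hq
  have hp0 : x • P.one + y • f ≠ 0 := by
    intro h0
    apply hf
    rw [← P.mem_span_singleton_iff hw0, P.mul_one, hxyz, h0, zero_add]
    exact mem_span_singleton.2 ⟨z, rfl⟩
  have hq0 : q ≠ 0 := by
    rintro rfl
    rw [map_zero, span_zero_singleton, eq_comm, span_singleton_eq_bot] at hq
    exact hp0 hq
  have hmem : P.mul w q ∈ F ∙ (x • P.one + y • f) := hq ▸ mem_span_singleton_self _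
  refine hw (P.mem_span_pair_of_mul_mem h hq0 hw0 ?_ ?_)
  · rw [← P.mem_span_pair_iff w hw0, P.mul_one]
    refine (span_singleton_le_iff_mem _ _).2 ?_ hmem
    exact mem_span_pair.2 ⟨-z, 1, by rw [hxyz]; module⟩
  · exact (span_singleton_le_iff_mem _ _).2 (mem_span_pair.2 ⟨x, y, rfl⟩) hmem

theorem ringHom_apply_eq_of_mul_ne {f w : V} (hf : f ∉ F ∙ P.one) (hw : w ∉ span F {P.one, f})
    (hwf : ∀ x y z : F, P.mul w f ≠ x • P.one + y • f + z • w) (t : F) :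
    P.σ (P.one + f) t = t := by
  obtain ⟨k, hk⟩ := P.exists_mul_eq_smul_mul (P.one + f) w
  rw [map_add (P.mul w), P.mul_one] at hk
  obtain ⟨d, hd⟩ := P.exists_mul_eq_smul_mul f w
  -- Expand (1 + tw)(1 + f) and its reverse in the coordinates 1, f, w, w·f. The value t = 1 then
  -- gives k = 1.
  have key : ∀ t : F, t = P.σ (P.one + f) t * k := by
    intro t
    obtain ⟨l, hl⟩ := P.exists_mul_eq_smul_mul (P.one + t • w) f
    rw [map_add (P.mul f), P.mul_one, map_smulₛₗ, hd] at hl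
    obtain ⟨c, hc⟩ := P.exists_mul_eq_smul_mul (P.one + t • w) (P.one + f)
    rw [map_add, P.mul_one, hl, map_add (P.mul (P.one + f)), map_smulₛₗ, P.mul_one, hk] at hc
    set s := P.σ (P.one + f) t
    have h₀ : l * (P.σ f t * d) - c * (s * k) = 0 := by
      by_contra h₀
      refine hwf ((l * (P.σ f t * d) - c * (s * k))⁻¹ * (c - 1))
        ((l * (P.σ f t * d) - c * (s * k))⁻¹ * (c - l))
        ((l * (P.σ f t * d) - c * (s * k))⁻¹ * (c * (s * k) - t)) ?_
      rw [← sub_eq_zero] at hc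
      have h' : (l * (P.σ f t * d) - c * (s * k)) • P.mul w f =
          (c - 1) • P.one + (c - l) • f + (c * (s * k) - t) • w := by
        rw [← sub_eq_zero, ← hc]
        module
      rw [← inv_smul_smul₀ h₀ (P.mul w f), h']
      module
    obtain ⟨h₁, -, h₃⟩ := coeff_eq_of_not_mem_span_pair P.one_ne_zero hf hw
      (a := 1) (b := l) (c := t) (a' := c) (b' := c) (c' := c * (s * k))
      (by
        have h₄ : (l * (P.σ f t * d) - c * (s * k)) • P.mul w f = 0 := by rw [h₀, zero_smul]
        linear_combination (norm := module) hc - h₄)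
    rw [h₃, ← h₁, one_mul]
  have hk1 : k = 1 := by simpa using (key 1).symm
  simpa [hk1] using (key t).symm

theorem isEmpty_of_isAlgClosed [IsAlgClosed F] [NeZero (2 : F)] [FiniteDimensional F V]
    (hdim : ∀ v w : V, ∃ u, u ∉ span F {v, w}) :
    IsEmpty (SemilinearProduct F V) := by
  refine ⟨fun P => ?_⟩
  by_cases h : ∀ f, P.mul f f ∈ span F {P.one, f}
  · obtain ⟨f, hf⟩ := hdim P.one P.one
    rw [Set.pair_eq_singleton] at hf
    obtain ⟨w, hw⟩ := hdim P.one f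
    obtain ⟨a, ha⟩ := P.exists_ringHom_apply_ne (v := P.one + f)
      (fun h => hf (((F ∙ P.one).add_mem_iff_right (mem_span_singleton_self _)).1 h))
    exact ha (P.ringHom_apply_eq_of_mul_ne hf hw (P.mul_not_mem_span_triple h hf hw) a)
  · push Not at h
    obtain ⟨f, hff⟩ := h
    have hf : f ∉ F ∙ P.one := by
      intro hf
      obtain ⟨c, rfl⟩ := mem_span_singleton.1 hf
      by_cases hc : c • P.one = 0
      · simp [hc] at hff
      · apply hff
        have : P.mul (c • P.one) (c • P.one) ∈ F ∙ P.mul (c • P.one) P.one :=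
          (P.mem_span_singleton_iff hc _ _).2 hf
        rw [P.mul_one] at this
        exact (span_singleton_le_iff_mem _ _).2 (subset_span (by simp)) this
    obtain ⟨a, ha⟩ := P.exists_ringHom_apply_ne hf
    exact ha (P.ringHom_apply_eq_of_mul_self_not_mem hf hff a)

end SemilinearProduct

end AlgClosed

/-! ### Linear products: commutation up to sign and commutative domains. -/

open scoped IsMulCommutative

section RealClosed

theorem finrank_le_two_of_irreducible {F K : Type*} [Field F] [CharZero F]
    (hF : ∀ p : Polynomial F, Irreducible p → p.natDegree ≤ 2) [CommRing K] [IsDomain K]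
    [Algebra F K] [FiniteDimensional F K] : Module.finrank F K ≤ 2 := by
  let : Field K := (isField_of_isIntegral_of_isField' (R := F) (Field.toIsField F)).toField
  obtain ⟨x, hx⟩ := Field.exists_primitive_element F K
  rw [(Field.primitive_element_iff_minpoly_natDegree_eq F x).1 hx |>.symm]
  exact hF _ (minpoly.irreducible (Algebra.IsIntegral.isIntegral x))

variable {F V : Type*} [Field F] [AddCommGroup V] [Module F V]

open Submodule

/-- Every vector is an eigenvector of (gf)⁻¹fg, which is therefore a scalar; determinants show that
it is a root of unity. -/
theorem exists_mul_eq_smul_mul_of_span_eq [FiniteDimensional F V] {f g : Module.End F V}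
    (hf : IsUnit f) (hg : IsUnit g)
    (h : ∀ w, (F ∙ f (g w)) = F ∙ g (f w)) :
    ∃ c : F, c ^ Module.finrank F V = 1 ∧ f * g = c • (g * f) := by
  obtain ⟨u, hu⟩ := hg.mul hf
  have huapp : ∀ w, (↑u⁻¹ : Module.End F V) (g (f w)) = w := by
    intro w
    have : ((↑u⁻¹ : Module.End F V) * (g * f)) w = w := by rw [← hu, Units.inv_mul]; rfl
    exact this
  obtain ⟨c, hc⟩ := LinearMap.exists_eq_smul_id_of_forall_notLinearIndependent
    (f := (↑u⁻¹ : Module.End F V) * (f * g)) (by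
      intro w hw
      have h₁ : f (g w) ∈ F ∙ g (f w) := h w ▸ mem_span_singleton_self _
      obtain ⟨c, hc⟩ := mem_span_singleton.1 h₁
      have h₂ : ((↑u⁻¹ : Module.End F V) * (f * g)) w = c • w := by
        rw [Module.End.mul_apply, Module.End.mul_apply, ← hc, map_smul, huapp]
      rw [h₂] at hw
      have := LinearIndependent.pair_iff.1 hw (-c) 1 (by simp)
      exact one_ne_zero this.2)
  have hfg : f * g = c • (g * f) := by
    rw [← Units.mul_right_inj u⁻¹, hc, mul_smul_comm, ← hu, Units.inv_mul]
  refine ⟨c, ?_, hfg⟩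
  have hdet := congrArg LinearMap.det hfg
  rw [LinearMap.det_smul, map_mul, map_mul, mul_comm (LinearMap.det g)] at hdet
  have h₀ : LinearMap.det f * LinearMap.det g ≠ 0 :=
    mul_ne_zero (hf.map LinearMap.det).ne_zero (hg.map LinearMap.det).ne_zero
  exact mul_right_cancel₀ h₀ (by rw [one_mul, ← hdet])

/-- Operators commuting up to sign with a family of operators `M`: finitely many sign patterns
occur, and quotients of operators with the same pattern commute with the whole family. -/
theorem exists_unit_span_eq_top [Infinite F] [FiniteDimensional F V] [Nontrivial V]
    {M : V → Module.End F V} (hM : ∀ v, v ≠ 0 → IsUnit (M v))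
    (hcomm : ∀ u v, u ≠ 0 → v ≠ 0 → M u * M v = M v * M u ∨ M u * M v = -(M v * M u)) :
    ∃ (s : Set V) (u : (Module.End F V)ˣ), span F s = ⊤ ∧ (∀ v ∈ s, v ≠ 0) ∧
      (∃ v₀, v₀ ≠ 0 ∧ u = M v₀) ∧ ∀ v ∈ s, ∀ w, w ≠ 0 → Commute (↑u⁻¹ * M v) (M w) := by
  obtain ⟨b, hbs, hspan, hli⟩ := exists_linearIndependent F (M '' {v | v ≠ 0})
  have hbfin : Finite b := hli.setFinite
  have hb : ∀ v, v ≠ 0 → ∀ X ∈ b, M v * X = X * M v ∨ M v * X = -(X * M v) := by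
    intro v hv X hX
    obtain ⟨w, hw, rfl⟩ := hbs hX
    exact hcomm v w hv hw
  let s (T : Set b) : Set V := {v | v ≠ 0 ∧ {X : b | Commute (M v) X} = T}
  -- Every nonzero vector lies in the class of its own pattern, and a space over an infinite field
  -- is not a finite union of proper subspaces.
  obtain ⟨T, hT⟩ : ∃ T, span F (s T) = ⊤ := by
    by_contra! hne
    obtain ⟨x, hx⟩ := exists_forall_notMem_of_forall_ne_top _ hne
    by_cases hx0 : x = 0
    · exact hx ∅ (hx0 ▸ zero_mem _)
    · exact hx _ (subset_span ⟨hx0, rfl⟩)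
  by_cases hne : (s T).Nonempty
  swap
  · rw [Set.not_nonempty_iff_eq_empty] at hne
    rw [hne, span_empty] at hT
    exact absurd hT bot_ne_top
  obtain ⟨v₀, hv₀, hv₀T⟩ := hne
  obtain ⟨u, hu⟩ := hM v₀ hv₀
  refine ⟨s T, u, hT, fun v hv => hv.1, ⟨v₀, hv₀, hu⟩, fun v hv w hw => ?_⟩
  have hbX : ∀ X ∈ b, Commute (↑u⁻¹ * M v) X := by
    intro X hX
    by_cases hXT : (⟨X, hX⟩ : b) ∈ T
    · have h₁ : Commute (M v) X := by rw [← hv.2] at hXT; exact hXT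
      have h₂ : Commute (u : Module.End F V) X := by rw [← hv₀T] at hXT; rw [hu]; exact hXT
      exact h₂.units_inv_left.mul_left h₁
    · have h₁ : M v * X = -(X * M v) := by
        refine (hb v hv.1 X hX).resolve_left fun h => ?_
        rw [← hv.2] at hXT
        exact hXT h
      have h₂ : ↑u * X = -(X * ↑u) := by
        rw [hu]
        refine (hb v₀ hv₀ X hX).resolve_left fun h => ?_
        rw [← hv₀T] at hXT
        exact hXT h
      have h₃ : (↑u⁻¹ : Module.End F V) * X = -(X * ↑u⁻¹) := by
        rw [← Units.mul_right_inj u, Units.mul_inv_cancel_left, mul_neg, ← mul_assoc, h₂, neg_mul,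
          neg_neg, mul_assoc, Units.mul_inv, mul_one]
      rw [commute_iff_eq, mul_assoc, h₁, mul_neg, ← mul_assoc, h₃, neg_mul, neg_neg, mul_assoc]
  have hle : span F b ≤ Subalgebra.toSubmodule (Subalgebra.centralizer F {↑u⁻¹ * M v}) := by
    rw [span_le]
    intro X hX
    simp only [SetLike.mem_coe, Subalgebra.mem_toSubmodule, Subalgebra.mem_centralizer_iff,
      Set.mem_singleton_iff, forall_eq]
    exact hbX X hX
  have hmem : M w ∈ span F b := hspan ▸ subset_span ⟨w, hw, rfl⟩
  exact Subalgebra.mem_centralizer_iff F |>.1 (hle hmem) _ rfl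

theorem finrank_le_two_of_commute_up_to_sign [CharZero F]
    (hF : ∀ p : Polynomial F, Irreducible p → p.natDegree ≤ 2) [FiniteDimensional F V] {e : V}
    {M : V → Module.End F V} (he : ∀ v, M v e = v) (hM : ∀ v, v ≠ 0 → IsUnit (M v))
    (hcomm : ∀ u v, u ≠ 0 → v ≠ 0 → M u * M v = M v * M u ∨ M u * M v = -(M v * M u))
    (htrans : ∀ x, x ≠ 0 → ∀ y, y ≠ 0 → ∃ w, w ≠ 0 ∧ y ∈ F ∙ M w x) : Module.finrank F V ≤ 2 := by
  by_cases hV : Subsingleton V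
  · rw [Module.finrank_zero_of_subsingleton]
    exact zero_le
  rw [not_subsingleton_iff_nontrivial] at hV
  obtain ⟨s, u, hs, hs0, ⟨v₀, hv₀, hu₀⟩, hcom⟩ := exists_unit_span_eq_top hM hcomm
  let t : Set (Module.End F V) := (fun v => ↑u⁻¹ * M v) '' s
  have hu : ∀ v ∈ s, Commute (↑u⁻¹ * M v) (u : Module.End F V) := fun v hv =>
    hu₀ ▸ hcom v hv v₀ hv₀
  have ht : ∀ a ∈ t, ∀ b ∈ t, a * b = b * a := by
    rintro _ ⟨v, hv, rfl⟩ _ ⟨w, hw, rfl⟩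
    exact ((hu v hv).units_inv_right).mul_right (hcom v hv w (hs0 w hw))
  let A := Algebra.adjoin F t
  have : IsMulCommutative A := Algebra.isMulCommutative_adjoin F ht
  have hA : ∀ a ∈ A, ∀ w, w ≠ 0 → Commute a (M w) := by
    intro a ha w hw
    have hle : A ≤ Subalgebra.centralizer F {M w} := by
      refine Algebra.adjoin_le ?_
      rintro _ ⟨v, hv, rfl⟩
      rw [SetLike.mem_coe, Subalgebra.mem_centralizer_iff]
      rintro _ rfl
      exact (hcom v hv w hw).symm
    exact (Subalgebra.mem_centralizer_iff F |>.1 (hle ha) _ rfl).symm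
  -- Schur's argument: `a` commutes with the transitive family `M`, so killing one nonzero vector
  -- kills all.
  have hker : ∀ a ∈ A, ∀ x, x ≠ 0 → a x = 0 → a = 0 := by
    intro a ha x hx hax
    ext y
    by_cases hy : y = 0
    · simp [hy]
    obtain ⟨w, hw, h⟩ := htrans x hx y hy
    obtain ⟨c, rfl⟩ := mem_span_singleton.1 h
    have : a (M w x) = M w (a x) := congrArg (fun f => f x) (hA a ha w hw).eq
    simp [this, hax]
  have : NoZeroDivisors A := by
    refine ⟨fun {a b} hab => or_iff_not_imp_right.2 fun hb => ?_⟩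
    obtain ⟨x, hx⟩ : ∃ x, (b : Module.End F V) x ≠ 0 := by
      by_contra! h
      exact hb (Subtype.ext (LinearMap.ext h))
    refine Subtype.ext (hker a a.2 _ hx ?_)
    exact congrArg (fun f : A => (f : Module.End F V) x) hab
  have : IsDomain A := NoZeroDivisors.to_isDomain A
  refine le_trans ?_ (finrank_le_two_of_irreducible (K := A) hF)
  let ev : A →ₗ[F] V := (LinearMap.applyₗ e).comp A.val.toLinearMap
  refine LinearMap.finrank_le_finrank_of_surjective (f := ev) ?_
  rw [← LinearMap.range_eq_top, eq_top_iff]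
  intro x _
  have hx : (u : Module.End F V) x ∈ span F s := by rw [hs]; trivial
  -- Evaluating u⁻¹ M(v) at e gives u⁻¹v, and these vectors span V because `s` does.
  have hle : span F s ≤ (LinearMap.range ev).comap (↑u⁻¹ : Module.End F V) := by
    rw [span_le]
    intro v hv
    refine ⟨⟨↑u⁻¹ * M v, Algebra.subset_adjoin ⟨v, hv, rfl⟩⟩, ?_⟩
    change (↑u⁻¹ : Module.End F V) (M v e) = _
    rw [he]
  have := hle hx
  rwa [mem_comap, ← Module.End.mul_apply, Units.inv_mul] at this

end RealClosed

/-! ### The real and complex cases. -/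

section ArchimedeanLocalField

open Submodule

theorem isAlgClosed_of_ringEquiv {F K : Type*} [Field F] [Field K] [IsAlgClosed K] (e : F ≃+* K) :
    IsAlgClosed F := by
  refine IsAlgClosed.of_exists_root F fun p _ hp => ?_
  obtain ⟨z, hz⟩ := IsAlgClosed.exists_root (p.map (e : F →+* K))
    (by rw [Polynomial.degree_map]; exact (Polynomial.degree_pos_of_irreducible hp).ne')
  refine ⟨e.symm z, e.injective ?_⟩
  rw [Polynomial.IsRoot, Polynomial.eval_map] at hz
  have h := Polynomial.hom_eval₂ p (RingHom.id F) (e : F →+* K) (e.symm z)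
  rw [RingHom.comp_id, RingHom.coe_coe, e.apply_symm_apply, hz] at h
  rw [map_zero]
  exact h

theorem SemilinearProduct.finrank_le_two_of_real {F V : Type*} [Field F] [AddCommGroup V]
    [Module F V] [FiniteDimensional F V] (P : SemilinearProduct F V) (e : F ≃+* ℝ) :
    Module.finrank F V ≤ 2 := by
  have hσ : ∀ (v : V) (a : F), P.σ v a = a := by
    intro v a
    -- The only ring endomorphism of ℝ is the identity, since the order is determined by squares.
    have h : ((e : F →+* ℝ).comp (P.σ v)).comp (e.symm : ℝ →+* F) = (RingHom.id ℝ) :=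
      Subsingleton.elim _ _
    have h' : e (P.σ v (e.symm (e a))) = e a := RingHom.congr_fun h (e a)
    rw [e.symm_apply_apply] at h'
    exact e.injective h'
  have : CharZero F := charZero_of_injective_ringHom (f := e.symm.toRingHom) e.symm.injective
  have hirr : ∀ p : Polynomial F, Irreducible p → p.natDegree ≤ 2 := by
    intro p hp
    have h := Irreducible.natDegree_le_two ((MulEquiv.irreducible_iff (Polynomial.mapEquiv e)).2 hp)
    rwa [Polynomial.mapEquiv_apply, Polynomial.natDegree_map_eq_of_injective e.injective] at h
  let M : V → Module.End F V := fun v =>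
    { toFun := P.mul v
      map_add' := map_add _
      map_smul' := fun a x => by simp [hσ] }
  have hM : ∀ v, v ≠ 0 → IsUnit (M v) := by
    intro v hv
    rw [LinearMap.isUnit_iff_ker_eq_bot, LinearMap.ker_eq_bot']
    intro x hx
    by_contra hx0
    exact P.mul_ne_zero hv hx0 hx
  refine finrank_le_two_of_commute_up_to_sign hirr (M := M) P.mul_one hM ?_ ?_
  · intro u v hu hv
    obtain ⟨c, hc, huv⟩ := exists_mul_eq_smul_mul_of_span_eq (hM u hu) (hM v hv)
      (P.span_mul_left_comm u v)
    have hpos : Module.finrank F V ≠ 0 := by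
      have : Nontrivial V := ⟨⟨u, 0, hu⟩⟩
      exact Module.finrank_pos.ne'
    have habs : |e c| = 1 := by
      rw [← pow_eq_one_iff_of_nonneg (abs_nonneg _) hpos, ← abs_pow, ← map_pow, hc, map_one,
        abs_one]
    rcases eq_or_eq_neg_of_abs_eq habs with h | h
    · left
      rw [huv, show c = 1 from e.injective (by rw [h, map_one]), one_smul]
    · right
      rw [huv, show c = -1 from e.injective (by rw [h, map_neg, map_one]), neg_smul, one_smul]
  · intro x hx y hy
    obtain ⟨w, hw⟩ := P.exists_span_mul_eq x hx y
    refine ⟨w, ?_, hw ▸ mem_span_singleton_self y⟩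
    rintro rfl
    rw [P.span_mul_comm, map_zero, span_zero_singleton, eq_comm, span_singleton_eq_bot] at hw
    exact hy hw

end ArchimedeanLocalField

theorem mainTheorem4 (F : Type*) [Field F] [TopologicalSpace F] (hF : IsArchimedeanLocalField F)
    (n : ℕ) (hn : 1 < n) :
    ¬ AdmitsIncidenceAbelianGroup F (Fin (n + 1) → F) ∧
    ¬ AdmitsContinuousIncidenceAbelianGroup F (Fin (n + 1) → F) := by
  have key : ¬ AdmitsIncidenceAbelianGroup F (Fin (n + 1) → F) := by
    rintro ⟨G, hG⟩
    have hdim : ∀ v w : Fin (n + 1) → F, ∃ u, u ∉ Submodule.span F {v, w} := by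
      intro v w
      by_contra! h
      have htop : Submodule.span F {v, w} = ⊤ := Submodule.eq_top_iff'.2 h
      have hle := finrank_range_le_card (R := F) ![v, w]
      rw [Matrix.range_cons_cons_empty, Set.finrank, htop, finrank_top, Module.finrank_fin_fun,
        Fintype.card_fin] at hle
      omega
    obtain ⟨P⟩ := hG.nonempty_semilinearProduct hdim
    rcases hF.real_or_complex with ⟨e, -⟩ | ⟨e, -⟩
    · have := P.finrank_le_two_of_real e
      rw [Module.finrank_fin_fun] at this
      omega
    · have : CharZero F := charZero_of_injective_ringHom (f := e.symm.toRingHom) e.symm.injective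
      have : IsAlgClosed F := isAlgClosed_of_ringEquiv e
      exact (SemilinearProduct.isEmpty_of_isAlgClosed hdim).false P
  exact ⟨key, fun ⟨G, hG, _⟩ => key ⟨G, hG⟩⟩
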